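/- Let $P\in\mathbb{Z}$ and $Q\ge 1$ be coprime, and let $\alpha=P/Q$. For $\nu_x,\nu_y\in\mathbb{R}$ let $\hat H(\nu_x,\nu_y)$ be the finite-dimensional Hofstadter Hamiltonian, i.e. the $Q\times Q$ complex matrix $$\hat H(\nu_x,\nu_y)=e^{i\nu_x}V+e^{-i\nu_x}V^*+e^{-i\nu_y}U+e^{i\nu_y}U^*,$$ with rows and columns indexed by $0,\dots,Q-1$, where $V$ is the cyclic shift matrix ($V_{m,n}=1$ if $n\equiv m+1 \pmod Q$, and $V_{m,n}=0$ otherwise) and $U=\mathrm{diag}(1,\omega,\dots,\omega^{Q-1})$ with $\omega=e^{2\pi i\alpha}$. Thus, $\hat H$ is the matrix of the $Q$-periodic Harper operator $(\hat H g)_n=e^{i\nu_x}g_{n+1}+e^{-i\nu_x}g_{n-1}+2\cos(2\pi n\alpha-\nu_y)g_n$. Let $\hat H$ denote its value at the mid-band point $(\nu_x,\nu_y)=\left(\frac{\pi}{2Q},\frac{\pi}{2Q}\right)$, and let $f(E)=\det(\hat H-E)$. Then, for all $E\in\mathbb{C}$, $$f(E)=\sum_{i=0}^{\lfloor Q/2\rfloor}(-1)^{Q+i}\,4^i\,E^{Q-2i}\,\tilde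 e_i\bigl(\sin^2(\pi\alpha),\sin^2(2\pi\alpha),\dots,\sin^2((Q-1)\pi\alpha)\bigr),$$ where $$\tilde e_k(x_1,\dots,x_n)=\sum_{\substack{1\le j_1<j_2<\cdots<j_k\le n\\ |j_{i}-j_{i+1}|\ge 2}}x_{j_1}\cdots x_{j_k},\qquad \tilde e_0=1.$$ -/

import Mathlib

/-- The shift matrix `V` of order `Q`: the entry `(m, n)` is `1` when `n ≡ m + 1` modulo `Q`,
and `0` otherwise. -/
noncomputable def shiftMatrix (Q : ℕ) : Matrix (Fin Q) (Fin Q) ℂ :=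
  Matrix.of fun m n => if ((m : ℕ) + 1) % Q = (n : ℕ) then 1 else 0

/-- The clock matrix `U = diag(1, ω, …, ω^(Q-1))` of order `Q`, where `ω = exp(2πiα)`. -/
noncomputable def clockMatrix (Q : ℕ) (α : ℝ) : Matrix (Fin Q) (Fin Q) ℂ :=
  Matrix.diagonal fun n => Complex.exp (2 * Real.pi * Complex.I * α) ^ (n : ℕ)

/-- The finite-dimensional Hofstadter Hamiltonian with flux `α` at the point `(νx, νy)` of the
Brillouin zone. With `z = exp(i νx)`, its diagonal part has the entries `2 cos(2πnα - νy)` for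
`n = 0, …, Q - 1`, and its off-diagonal part has `z` in the positions `(n, n + 1)` and `z⁻¹` in the
positions `(n + 1, n)`, indices being taken modulo `Q` (contributions to the same position
add up). -/
noncomputable def hofstadterHamiltonian (Q : ℕ) (α νx νy : ℝ) : Matrix (Fin Q) (Fin Q) ℂ :=
  Complex.exp (Complex.I * νx) • shiftMatrix Q
    + Complex.exp (-(Complex.I * νx)) • (shiftMatrix Q).conjTranspose
    + Complex.exp (-(Complex.I * νy)) • clockMatrix Q α
    + Complex.exp (Complex.I * νy) • (clockMatrix Q α).conjTranspose

/-- The `2`-step elementary symmetric polynomial `ẽ_k(x_1, …, x_n)`: the sum of the products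
`x_{j_1} ⋯ x_{j_k}` over all `1 ≤ j_1 < ⋯ < j_k ≤ n` in which any two indices differ by at
least `2`. -/
def twoStepEsymm {R : Type*} [CommSemiring R] (k n : ℕ) (x : ℕ → R) : R :=
  ∑ S ∈ (Finset.powersetCard k (Finset.Icc 1 n)).filter
      (fun S => ∀ i ∈ S, ∀ j ∈ S, i < j → i + 2 ≤ j),
    ∏ j ∈ S, x j

/-! ### The two-step elementary symmetric polynomials -/

/-! In a basis of chirps the mid-band Hamiltonian is tridiagonal with zero diagonal. Both `V` and
`U` send the chirp of index `k` to a multiple of that of index `k - 1`, and their adjoints raise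
`k`. With `z = exp(iν)` and `ε = -z⁻²` the coefficients become `z⁻¹(1 - ω^(-k))` and `z(1 -
ω^(k+1))`, which vanish at `k = 0` and `k = Q - 1`, so no corner entries survive. Such chirps are
`Q`-periodic because `z^Q = i` (`hofstadterHamiltonian_mulVec_chirp`,
`det_hofstadterHamiltonian_sub`).

The tridiagonal determinant and `ẽ_k` obey matching recurrences (`det_tridiagonal`), and opposite
off-diagonal entries multiply to `4 sin²(πjα)`. -/

theorem twoStepEsymm_zero {R : Type*} [CommSemiring R] (n : ℕ) (x : ℕ → R) :
    twoStepEsymm 0 n x = 1 := by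
  simp [twoStepEsymm, Finset.filter_singleton]

theorem twoStepEsymm_succ_zero {R : Type*} [CommSemiring R] (k : ℕ) (x : ℕ → R) :
    twoStepEsymm (k + 1) 0 x = 0 := by
  have h : Finset.powersetCard (k + 1) (Finset.Icc 1 0) = ∅ :=
    Finset.powersetCard_eq_empty.2 (by simp)
  rw [twoStepEsymm, h, Finset.filter_empty, Finset.sum_empty]

/-- Split on whether `n + 1` is chosen; if so, `n` is excluded. For `n = 0` the truncated `n - 1`
still gives an empty index range. -/
theorem twoStepEsymm_succ_succ {R : Type*} [CommSemiring R] (k n : ℕ) (x : ℕ → R) :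
    twoStepEsymm (k + 1) (n + 1) x
      = twoStepEsymm (k + 1) n x + x (n + 1) * twoStepEsymm k (n - 1) x := by
  classical
  have hnot : n + 1 ∉ Finset.Icc 1 n := by simp
  have hset : ((Finset.powersetCard k (Finset.Icc 1 n)).filter
        (fun S => ∀ i ∈ insert (n + 1) S, ∀ j ∈ insert (n + 1) S, i < j → i + 2 ≤ j))
      = (Finset.powersetCard k (Finset.Icc 1 (n - 1))).filter
        (fun S => ∀ i ∈ S, ∀ j ∈ S, i < j → i + 2 ≤ j) := by
    ext S
    simp only [Finset.mem_filter, Finset.mem_powersetCard]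
    constructor
    · rintro ⟨⟨hS, hc⟩, h⟩
      refine ⟨⟨fun i hi => ?_, hc⟩, fun i hi j hj =>
        h i (Finset.mem_insert_of_mem hi) j (Finset.mem_insert_of_mem hj)⟩
      have h1 := Finset.mem_Icc.1 (hS hi)
      have h2 := h i (Finset.mem_insert_of_mem hi) (n + 1) (Finset.mem_insert_self _ _) (by omega)
      exact Finset.mem_Icc.2 ⟨h1.1, by omega⟩
    · rintro ⟨⟨hS, hc⟩, h⟩
      have hb : ∀ i ∈ S, 1 ≤ i ∧ i ≤ n - 1 := fun i hi => Finset.mem_Icc.1 (hS hi)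
      refine ⟨⟨fun i hi => ?_, hc⟩, fun i hi j hj hij => ?_⟩
      · have := hb i hi
        exact Finset.mem_Icc.2 ⟨this.1, by omega⟩
      · rcases Finset.mem_insert.1 hi with rfl | hi <;> rcases Finset.mem_insert.1 hj with rfl | hj
        · omega
        · have := hb j hj
          omega
        · have := hb i hi
          omega
        · exact h i hi j hj hij
  have hdisj : Disjoint
      ((Finset.powersetCard (k + 1) (Finset.Icc 1 n)).filter
        (fun S => ∀ i ∈ S, ∀ j ∈ S, i < j → i + 2 ≤ j))
      (((Finset.powersetCard k (Finset.Icc 1 n)).image (insert (n + 1))).filter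
        (fun S => ∀ i ∈ S, ∀ j ∈ S, i < j → i + 2 ≤ j)) := by
    rw [Finset.disjoint_left]
    intro S hS hS'
    simp only [Finset.mem_filter, Finset.mem_powersetCard, Finset.mem_image] at hS hS'
    obtain ⟨⟨T, -, rfl⟩, -⟩ := hS'
    exact hnot (hS.1.1 (Finset.mem_insert_self _ _))
  have hmem : ∀ S ∈ (Finset.powersetCard k (Finset.Icc 1 (n - 1))).filter
      (fun S => ∀ i ∈ S, ∀ j ∈ S, i < j → i + 2 ≤ j), n + 1 ∉ S := by
    intro S hS hn
    have := Finset.mem_Icc.1 ((Finset.mem_powersetCard.1 (Finset.mem_filter.1 hS).1).1 hn)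
    omega
  unfold twoStepEsymm
  rw [← Finset.insert_Icc_right_eq_Icc_add_one (by omega : 1 ≤ n + 1),
    Finset.powersetCard_succ_insert hnot, Finset.filter_union, Finset.sum_union hdisj,
    Finset.filter_image, hset, Finset.mul_sum, Finset.sum_image]
  · congr 1
    exact Finset.sum_congr rfl fun S hS => Finset.prod_insert (hmem S hS)
  · intro S hS T hT hST
    rw [← Finset.erase_insert (hmem S hS), ← Finset.erase_insert (hmem T hT)]
    exact congrArg (fun s => Finset.erase s (n + 1)) hST

theorem twoStepEsymm_eq_zero {R : Type*} [CommSemiring R] (x : ℕ → R) (n : ℕ) :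
    ∀ k, n + 1 < 2 * k → twoStepEsymm k n x = 0 := by
  induction n using Nat.strong_induction_on with
  | _ n ih =>
    intro k hk
    obtain ⟨k, rfl⟩ : ∃ l, k = l + 1 := ⟨k - 1, by omega⟩
    rcases n with _ | n
    · exact twoStepEsymm_succ_zero k x
    · rw [twoStepEsymm_succ_succ, ih n (by omega) _ (by omega),
        ih (n - 1) (by omega) k (by omega), mul_zero, add_zero]

/-! ### Determinants of tridiagonal matrices with constant diagonal -/

/-- The tridiagonal matrix of order `n` with diagonal entries `a`, entry `b i` in the position
`(i, i - 1)` and entry `c j` in the position `(j - 1, j)`. -/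
def tridiagonal {R : Type*} [CommRing R] (a : R) (b c : ℕ → R) (n : ℕ) :
    Matrix (Fin n) (Fin n) R :=
  Matrix.of fun i j => if (i : ℕ) = j then a else
    if (j : ℕ) + 1 = i then b i else if (i : ℕ) + 1 = j then c j else 0

theorem det_tridiagonal_succ_succ {R : Type*} [CommRing R] (a : R) (b c : ℕ → R) (n : ℕ) :
    (tridiagonal a b c (n + 2)).det
      = a * (tridiagonal a b c (n + 1)).det
        - b (n + 1) * c (n + 1) * (tridiagonal a b c n).det := by
  -- With the last row and the next-to-last column deleted, the last column has only its bottom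
  -- entry `c (n + 1)`.
  have hminor : ((tridiagonal a b c (n + 2)).submatrix Fin.castSucc
      (Fin.succAbove (Fin.castSucc (Fin.last n)))).det
        = c (n + 1) * (tridiagonal a b c n).det := by
    rw [Matrix.det_succ_column _ (Fin.last n), Fin.sum_univ_castSucc, Finset.sum_eq_zero]
    · have hsub : ((tridiagonal a b c (n + 2)).submatrix Fin.castSucc
          (Fin.succAbove (Fin.castSucc (Fin.last n)))).submatrix Fin.castSucc Fin.castSucc
            = tridiagonal a b c n := by
        ext i j
        have : (Fin.castSucc (Fin.last n)).succAbove (Fin.castSucc j)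
            = Fin.castSucc (Fin.castSucc j) :=
          Fin.succAbove_of_castSucc_lt _ _ (by simp [Fin.lt_def])
        simp [tridiagonal, this]
      have heven : (-1 : R) ^ (n + n) = 1 := Even.neg_one_pow ⟨n, rfl⟩
      have hentry : (tridiagonal a b c (n + 2)).submatrix Fin.castSucc
          (Fin.succAbove (Fin.castSucc (Fin.last n))) (Fin.last n) (Fin.last n) = c (n + 1) := by
        simp [tridiagonal, show n + 1 + 1 ≠ n by omega]
      rw [Fin.succAbove_last, hsub, hentry, Fin.val_last, heven, zero_add, one_mul]
    · intro i _
      have h1 : (i : ℕ) ≠ n + 1 := by omega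
      have h2 : (n + 1) + 1 ≠ (i : ℕ) := by omega
      have h3 : (i : ℕ) ≠ n := by omega
      simp [tridiagonal, h1, h2, h3]
  rw [Matrix.det_succ_row _ (Fin.last (n + 1)), Fin.sum_univ_castSucc, Fin.sum_univ_castSucc,
    Finset.sum_eq_zero, zero_add]
  · have hsub : (tridiagonal a b c (n + 2)).submatrix Fin.castSucc Fin.castSucc
        = tridiagonal a b c (n + 1) := by
      ext i j
      simp [tridiagonal]
    have heven : (-1 : R) ^ (n + 1 + (n + 1)) = 1 := Even.neg_one_pow ⟨n + 1, rfl⟩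
    have hodd : (-1 : R) ^ (n + 1 + n) = -1 := Odd.neg_one_pow ⟨n, by ring⟩
    have e1 : tridiagonal a b c (n + 2) (Fin.last (n + 1)) (Fin.last (n + 1)) = a := by
      simp [tridiagonal]
    have e2 : tridiagonal a b c (n + 2) (Fin.last (n + 1)) (Fin.castSucc (Fin.last n))
        = b (n + 1) := by
      simp [tridiagonal]
    rw [Fin.succAbove_last, hminor, hsub, e1, e2]
    simp only [Fin.val_last, Fin.val_castSucc, heven, hodd]
    ring
  · intro j _
    have h1 : n + 1 ≠ (j : ℕ) := by omega
    have h2 : (j : ℕ) ≠ n := by omega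
    have h3 : n + 1 + 1 ≠ (j : ℕ) := by omega
    simp [tridiagonal, h1, h2, h3]

/-- Padding by zero terms lets sums for different `n` be compared index by index. -/
theorem sum_range_twoStepEsymm_eq {R : Type*} [CommRing R] (a : R) (y : ℕ → R) (n N : ℕ)
    (hN : n / 2 < N) :
    ∑ i ∈ Finset.range (n / 2 + 1), (-1) ^ i * a ^ (n - 2 * i) * twoStepEsymm i (n - 1) y
      = ∑ i ∈ Finset.range N, (-1) ^ i * a ^ (n - 2 * i) * twoStepEsymm i (n - 1) y := by
  refine Finset.sum_subset (Finset.range_mono (by omega)) fun i _ hi => ?_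
  rw [Finset.mem_range] at hi
  rw [twoStepEsymm_eq_zero y _ i (by omega), mul_zero]

theorem det_tridiagonal {R : Type*} [CommRing R] (a : R) (b c : ℕ → R) (n : ℕ) :
    (tridiagonal a b c n).det
      = ∑ i ∈ Finset.range (n / 2 + 1),
          (-1) ^ i * a ^ (n - 2 * i) * twoStepEsymm i (n - 1) (fun j => b j * c j) := by
  induction n using Nat.twoStepInduction with
  | zero => simp [twoStepEsymm_zero]
  | one => simp [twoStepEsymm_zero, tridiagonal]
  | more n ih₀ ih₁ =>
    rw [det_tridiagonal_succ_succ, ih₀, ih₁,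
      sum_range_twoStepEsymm_eq a _ n (n + 2) (by omega),
      sum_range_twoStepEsymm_eq a _ (n + 1) (n + 2 + 1) (by omega),
      sum_range_twoStepEsymm_eq a _ (n + 2) (n + 2 + 1) (by omega),
      Finset.sum_range_succ' _ (n + 2), Finset.sum_range_succ' _ (n + 2), mul_add, Finset.mul_sum,
      Finset.mul_sum, add_sub_right_comm, ← Finset.sum_sub_distrib]
    congr 1
    · refine Finset.sum_congr rfl fun i _ => ?_
      simp only [Nat.add_sub_cancel, show n + 2 - 1 = n + 1 from rfl,
        show n + 2 - 2 * (i + 1) = n - 2 * i by omega]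
      rw [twoStepEsymm_succ_succ]
      -- When `n < 2 * i + 1` the truncated exponents do not match, but their coefficient is zero.
      rcases Nat.lt_or_ge n (2 * i + 1) with h | h
      · rw [twoStepEsymm_eq_zero _ n (i + 1) (by omega)]
        ring
      · obtain ⟨m, rfl⟩ := Nat.exists_eq_add_of_le h
        rw [show 2 * i + 1 + m + 1 - 2 * (i + 1) = m by omega,
          show 2 * i + 1 + m - 2 * i = m + 1 by omega]
        ring
    · simp only [twoStepEsymm_zero]
      simp
      ring

theorem twoStepEsymm_mul_left {R : Type*} [CommSemiring R] (r : R) (k n : ℕ) (x : ℕ → R) :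
    twoStepEsymm k n (fun j => r * x j) = r ^ k * twoStepEsymm k n x := by
  unfold twoStepEsymm
  rw [Finset.mul_sum]
  refine Finset.sum_congr rfl fun S hS => ?_
  rw [Finset.prod_mul_distrib, Finset.prod_const,
    (Finset.mem_powersetCard.1 (Finset.mem_filter.1 hS).1).2]

/-- Taking `f` on `ℤ` gives all columns one formula; `hc` and `hb` cancel the out-of-range
neighbours `-1` and `n`. -/
theorem sum_mul_tridiagonal {R : Type*} [CommRing R] (a : R) (b c : ℕ → R) (n : ℕ)
    (hc : c 0 = 0) (hb : b n = 0) (f : ℤ → R) (k : Fin n) :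
    ∑ j : Fin n, f (j : ℕ) * tridiagonal a b c n j k
      = a * f (k : ℕ) + c k * f ((k : ℕ) - 1) + b (k + 1) * f ((k : ℕ) + 1) := by
  have hsplit : ∀ j : Fin n, f (j : ℕ) * tridiagonal a b c n j k
      = (if j = k then a * f (k : ℕ) else 0)
        + (if (j : ℕ) + 1 = k then c k * f ((k : ℕ) - 1) else 0)
        + (if (j : ℕ) = k + 1 then b (k + 1) * f ((k : ℕ) + 1) else 0) := by
    intro j
    simp only [tridiagonal, Matrix.of_apply, Fin.ext_iff]
    rcases eq_or_ne (j : ℕ) k with h | h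
    · simp [h, mul_comm]
    rcases eq_or_ne ((j : ℕ) + 1) k with h' | h'
    · have h2 : (k : ℕ) + 1 ≠ j := by omega
      have h3 : (j : ℕ) ≠ k + 1 := by omega
      have h4 : ((k : ℕ) : ℤ) - 1 = (j : ℕ) := by omega
      simp [h, h', h2, h3, h4, mul_comm]
    rcases eq_or_ne (j : ℕ) (k + 1) with h'' | h''
    · simp [h'', mul_comm, show (k : ℕ) + 1 + 1 ≠ k by omega]
    · simp [h, h', h'', h''.symm]
  have hlow : ∑ j : Fin n, (if (j : ℕ) + 1 = k then c k * f ((k : ℕ) - 1) else 0)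
      = c k * f ((k : ℕ) - 1) := by
    rcases Nat.eq_zero_or_pos (k : ℕ) with h | h
    · simp [h, hc]
    · rw [Finset.sum_eq_single ⟨(k : ℕ) - 1, by omega⟩]
      · exact if_pos (Nat.sub_add_cancel h)
      · intro j _ hj
        exact if_neg fun h' => hj (Fin.ext (by simp only; omega))
      · simp
  have hupp : ∑ j : Fin n, (if (j : ℕ) = k + 1 then b (k + 1) * f ((k : ℕ) + 1) else 0)
      = b (k + 1) * f ((k : ℕ) + 1) := by
    rcases eq_or_ne ((k : ℕ) + 1) n with h | h
    · simp [h, hb]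
    · rw [Finset.sum_eq_single ⟨(k : ℕ) + 1, by omega⟩]
      · exact if_pos rfl
      · intro j _ hj
        exact if_neg fun h' => hj (Fin.ext h')
      · simp
  rw [Finset.sum_congr rfl fun j _ => hsplit j, Finset.sum_add_distrib, Finset.sum_add_distrib,
    hlow, hupp, Finset.sum_ite_eq' Finset.univ k, if_pos (Finset.mem_univ k)]

/-! ### The shift matrix -/

theorem shiftMatrix_mulVec {Q : ℕ} (f : ℕ → ℂ) (hf : f Q = f 0) (m : Fin Q) :
    (shiftMatrix Q).mulVec (fun n => f n) m = f (m + 1) := by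
  have hlt : ((m : ℕ) + 1) % Q < Q := Nat.mod_lt _ m.pos
  have hval : f (((m : ℕ) + 1) % Q) = f (m + 1) := by
    rcases eq_or_ne ((m : ℕ) + 1) Q with h | h
    · rw [h, Nat.mod_self, hf]
    · rw [Nat.mod_eq_of_lt (by omega)]
  rw [Matrix.mulVec, dotProduct, Finset.sum_eq_single ⟨_, hlt⟩]
  · simp [shiftMatrix, hval]
  · intro j _ hj
    have : ((m : ℕ) + 1) % Q ≠ j := fun h => hj (Fin.ext h.symm)
    simp [shiftMatrix, this]
  · simp

theorem shiftMatrix_conjTranspose_mulVec {Q : ℕ} (f : ℕ → ℂ) (hf : f Q = f 0) (m : Fin Q) :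
    (shiftMatrix Q).conjTranspose.mulVec (fun n => f (n + 1)) m = f m := by
  have hQ := m.pos
  have hentry : ∀ n : Fin Q, (shiftMatrix Q).conjTranspose m n
      = if ((n : ℕ) + 1) % Q = m then 1 else 0 := by
    intro n
    rw [Matrix.conjTranspose_apply, shiftMatrix, Matrix.of_apply]
    split_ifs <;> simp
  have hmod : ∀ n : Fin Q, (n : ℕ) + 1 < Q ∧ ((n : ℕ) + 1) % Q = n + 1
      ∨ (n : ℕ) + 1 = Q ∧ ((n : ℕ) + 1) % Q = 0 := by
    intro n
    rcases eq_or_ne ((n : ℕ) + 1) Q with h | h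
    · exact Or.inr ⟨h, by rw [h, Nat.mod_self]⟩
    · exact Or.inl ⟨by omega, Nat.mod_eq_of_lt (by omega)⟩
  rw [Matrix.mulVec, dotProduct]
  simp only [hentry, ite_mul, one_mul, zero_mul]
  rcases Nat.eq_zero_or_pos (m : ℕ) with h | h
  · rw [Finset.sum_eq_single ⟨Q - 1, by omega⟩]
    · simp [Nat.sub_add_cancel hQ, h, hf]
    · intro n _ hn
      have : (n : ℕ) ≠ Q - 1 := fun h' => hn (Fin.ext h')
      exact if_neg fun h' => by have := hmod n; omega
    · simp
  · rw [Finset.sum_eq_single ⟨(m : ℕ) - 1, by omega⟩]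
    · simp [Nat.sub_add_cancel h, Nat.mod_eq_of_lt m.isLt]
    · intro n _ hn
      have : (n : ℕ) ≠ m - 1 := fun h' => hn (Fin.ext h')
      exact if_neg fun h' => by have := hmod n; omega
    · simp

/-! ### Chirps -/

/-- For even `Q`, `ω^(Q/2) = -1`; for odd `Q`, `Q` divides `Q.choose 2`. -/
theorem IsPrimitiveRoot.pow_choose_two {R : Type*} [CommRing R] [IsDomain R] {ω : R} {Q : ℕ}
    (hQ : 0 < Q) (hω : IsPrimitiveRoot ω Q) : ω ^ Q.choose 2 = (-1) ^ (Q + 1) := by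
  rcases Nat.even_or_odd' Q with ⟨m, rfl | rfl⟩
  · have hhalf : ω ^ m = -1 := by
      have h1 : ω ^ m * ω ^ m = 1 := by rw [← pow_add, ← two_mul, hω.pow_eq_one]
      exact (mul_self_eq_one_iff.1 h1).resolve_left (hω.pow_ne_one_of_pos_of_lt (by omega) (by omega))
    obtain ⟨l, rfl⟩ : ∃ l, m = l + 1 := ⟨m - 1, by omega⟩
    have hchoose : (2 * (l + 1)).choose 2 = (l + 1) * (2 * l + 1) := by
      rw [Nat.choose_two_right, mul_assoc, Nat.mul_div_cancel_left _ two_pos]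
      congr 1
    rw [hchoose, pow_mul, hhalf, Odd.neg_one_pow ⟨l, rfl⟩, Odd.neg_one_pow ⟨l + 1, rfl⟩]
  · have hchoose : (2 * m + 1).choose 2 = (2 * m + 1) * m := by
      rw [Nat.choose_two_right, Nat.add_sub_cancel, mul_left_comm,
        Nat.mul_div_cancel_left _ two_pos]
    rw [hchoose, pow_mul, hω.pow_eq_one, one_pow, Even.neg_one_pow ⟨m + 1, by ring⟩]

/-- The chirp with quadratic phase `ω ^ (n choose 2)` and linear phase `ε ω ^ (-k)`. -/
noncomputable def chirp (ε ω : ℂ) (k : ℤ) (n : ℕ) : ℂ :=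
  ε ^ n * ω ^ n.choose 2 * (ω ^ (-k)) ^ n

theorem chirp_sub_one {ε ω : ℂ} (hω : ω ≠ 0) (k : ℤ) (n : ℕ) :
    chirp ε ω (k - 1) n = ω ^ n * chirp ε ω k n := by
  rw [chirp, chirp, show -(k - 1) = -k + 1 by ring, zpow_add_one₀ hω, mul_pow]
  ring

theorem chirp_add_one {ε ω : ℂ} (hω : ω ≠ 0) (k : ℤ) (n : ℕ) :
    chirp ε ω (k + 1) n = (ω ^ n)⁻¹ * chirp ε ω k n := by
  have h := chirp_sub_one (ε := ε) hω (k + 1) n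
  rw [add_sub_cancel_right] at h
  rw [h, inv_mul_cancel_left₀ (pow_ne_zero n hω)]

/-- The quadratic phase turns translation into modulation, since `(n+1 choose 2) = (n choose 2) +
n`. -/
theorem chirp_apply_add_one {ε ω : ℂ} (hω : ω ≠ 0) (k : ℤ) (n : ℕ) :
    chirp ε ω k (n + 1) = ε * ω ^ (-k) * chirp ε ω (k - 1) n := by
  rw [chirp_sub_one hω, chirp, chirp, Nat.choose_succ_succ' n 1, Nat.choose_one_right]
  ring

theorem chirp_period {ε ω : ℂ} {Q : ℕ} (hQ : 0 < Q) (hω : IsPrimitiveRoot ω Q)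
    (hε : ε ^ Q = (-1) ^ (Q + 1)) (k : ℤ) : chirp ε ω k Q = chirp ε ω k 0 := by
  have h1 : (ω ^ (-k)) ^ Q = 1 := by
    rw [← zpow_natCast, zpow_comm, zpow_natCast, hω.pow_eq_one, one_zpow]
  rw [chirp, chirp, hε, hω.pow_choose_two hQ, h1, ← pow_add, Even.neg_one_pow ⟨Q + 1, rfl⟩]
  simp

/-- An invertible diagonal times a Vandermonde matrix with distinct nodes `ω^(-k)`. -/
theorem det_chirp_ne_zero {ε ω : ℂ} {Q : ℕ} (hε : ε ≠ 0) (hQ : 0 < Q)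
    (hω : IsPrimitiveRoot ω Q) :
    (Matrix.of fun n k : Fin Q => chirp ε ω (k : ℕ) n).det ≠ 0 := by
  have hω0 : ω ≠ 0 := hω.ne_zero hQ.ne'
  have hfac : (Matrix.of fun n k : Fin Q => chirp ε ω (k : ℕ) n)
      = Matrix.diagonal (fun n : Fin Q => ε ^ (n : ℕ) * ω ^ (n : ℕ).choose 2)
        * (Matrix.vandermonde fun k : Fin Q => ω ^ (-((k : ℕ) : ℤ))).transpose := by
    ext n k
    rw [Matrix.diagonal_mul, Matrix.transpose_apply, Matrix.vandermonde_apply, Matrix.of_apply,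
      chirp]
  rw [hfac, Matrix.det_mul, Matrix.det_diagonal, Matrix.det_transpose]
  refine mul_ne_zero (Finset.prod_ne_zero_iff.2 fun n _ =>
    mul_ne_zero (pow_ne_zero _ hε) (pow_ne_zero _ hω0)) (Matrix.det_vandermonde_ne_zero_iff.2 ?_)
  intro i j hij
  simp only [zpow_neg, zpow_natCast, inv_inj] at hij
  exact Fin.ext (hω.pow_inj i.isLt j.isLt hij)

/-! ### The mid-band Hamiltonian -/

theorem hofstadterHamiltonian_mulVec_chirp {Q : ℕ} {α ν : ℝ} {z ω : ℂ}
    (hz : z = Complex.exp (Complex.I * ν))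
    (hω : ω = Complex.exp (2 * Real.pi * Complex.I * α))
    (hper : ∀ k, chirp (-z⁻¹ ^ 2) ω k Q = chirp (-z⁻¹ ^ 2) ω k 0) (k : ℤ) (m : Fin Q) :
    (hofstadterHamiltonian Q α ν ν).mulVec (fun n => chirp (-z⁻¹ ^ 2) ω k n) m
      = z⁻¹ * (1 - ω ^ (-k)) * chirp (-z⁻¹ ^ 2) ω (k - 1) m
        + z * (1 - ω ^ (k + 1)) * chirp (-z⁻¹ ^ 2) ω (k + 1) m := by
  have hz0 : z ≠ 0 := hz ▸ Complex.exp_ne_zero _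
  have hω0 : ω ≠ 0 := hω ▸ Complex.exp_ne_zero _
  have hωconj : star ω = ω⁻¹ := by
    rw [hω, ← Complex.exp_neg, Complex.star_def, ← Complex.exp_conj]
    congr 1
    simp only [map_mul, Complex.conj_ofReal, Complex.conj_I, map_ofNat]
    ring
  have hV := shiftMatrix_mulVec _ (hper k) m
  have hV' : (shiftMatrix Q).conjTranspose.mulVec (fun n => chirp (-z⁻¹ ^ 2) ω k n) m
      = -z ^ 2 * ω ^ (k + 1) * chirp (-z⁻¹ ^ 2) ω (k + 1) m := by
    -- Written as a shifted chirp of index `k + 1`, the vector has its shift undone by `V*`.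
    have hfun : (fun n : Fin Q => chirp (-z⁻¹ ^ 2) ω k n)
        = (-z ^ 2 * ω ^ (k + 1)) • fun n : Fin Q => chirp (-z⁻¹ ^ 2) ω (k + 1) (n + 1) := by
      funext n
      have hpow : ω ^ (k + 1) ≠ 0 := zpow_ne_zero _ hω0
      rw [Pi.smul_apply, smul_eq_mul, chirp_apply_add_one hω0, add_sub_cancel_right, zpow_neg]
      field_simp
    rw [hfun, Matrix.mulVec_smul, Pi.smul_apply, smul_eq_mul,
      shiftMatrix_conjTranspose_mulVec _ (hper (k + 1))]
  have hU : (clockMatrix Q α).mulVec (fun n => chirp (-z⁻¹ ^ 2) ω k n) m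
      = chirp (-z⁻¹ ^ 2) ω (k - 1) m := by
    rw [clockMatrix, Matrix.mulVec_diagonal, ← hω, chirp_sub_one hω0]
  have hU' : (clockMatrix Q α).conjTranspose.mulVec (fun n => chirp (-z⁻¹ ^ 2) ω k n) m
      = chirp (-z⁻¹ ^ 2) ω (k + 1) m := by
    rw [clockMatrix, Matrix.diagonal_conjTranspose, Matrix.mulVec_diagonal, ← hω,
      chirp_add_one hω0, Pi.star_apply, star_pow, hωconj, inv_pow]
  rw [hofstadterHamiltonian]
  simp only [Matrix.add_mulVec, Matrix.smul_mulVec, Pi.add_apply, Pi.smul_apply, smul_eq_mul,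
    Complex.exp_neg, ← hz, hU, hU', hV', hV, chirp_apply_add_one hω0]
  field_simp
  ring

theorem det_hofstadterHamiltonian_sub {Q : ℕ} (hQ : 0 < Q) {α ν : ℝ} {z ω : ℂ}
    (hz : z = Complex.exp (Complex.I * ν))
    (hω : ω = Complex.exp (2 * Real.pi * Complex.I * α))
    (hprim : IsPrimitiveRoot ω Q) (hzQ : z ^ Q = Complex.I) (E : ℂ) :
    (hofstadterHamiltonian Q α ν ν - E • (1 : Matrix (Fin Q) (Fin Q) ℂ)).det
      = (tridiagonal (-E) (fun j => z * (1 - ω ^ j)) (fun j => z⁻¹ * (1 - (ω ^ j)⁻¹)) Q).det := by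
  have hz0 : z ≠ 0 := hz ▸ Complex.exp_ne_zero _
  -- The mid-band condition enters here: `z^(2Q) = -1`.
  have hε : (-z⁻¹ ^ 2) ^ Q = (-1) ^ (Q + 1) := by
    rw [neg_pow, ← pow_mul, mul_comm 2 Q, pow_mul, inv_pow, hzQ, inv_pow, Complex.I_sq, pow_succ]
    norm_num
  have hper := chirp_period hQ hprim hε
  have hS := det_chirp_ne_zero (neg_ne_zero.2 (pow_ne_zero 2 (inv_ne_zero hz0))) hQ hprim
  -- With `S` the chirp matrix and `T` the tridiagonal one, it suffices that `(H - E) S = S T`.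
  refine mul_right_cancel₀ hS ?_
  rw [← Matrix.det_mul, mul_comm (Matrix.det _), ← Matrix.det_mul]
  congr 1
  ext m k
  have hH := hofstadterHamiltonian_mulVec_chirp hz hω hper (k : ℕ) m
  have hT := sum_mul_tridiagonal (-E) (fun j => z * (1 - ω ^ j))
    (fun j => z⁻¹ * (1 - (ω ^ j)⁻¹)) Q (by simp) (by simp [hprim.pow_eq_one])
    (fun l => chirp (-z⁻¹ ^ 2) ω l m) k
  rw [sub_mul, Matrix.sub_apply, Matrix.smul_mul, one_mul, Matrix.smul_apply, Matrix.of_apply,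
    Matrix.mul_apply, Matrix.mul_apply]
  simp only [Matrix.mulVec, dotProduct] at hH
  simp only [Matrix.of_apply]
  rw [hT, hH, zpow_neg, zpow_natCast, zpow_add_one₀ (hω ▸ Complex.exp_ne_zero _), zpow_natCast,
    smul_eq_mul]
  ring

theorem one_sub_exp_mul_one_sub_inv (α : ℝ) (j : ℕ) :
    (1 - Complex.exp (2 * Real.pi * Complex.I * α) ^ j)
        * (1 - (Complex.exp (2 * Real.pi * Complex.I * α) ^ j)⁻¹)
      = 4 * ((Real.sin ((j : ℝ) * Real.pi * α) ^ 2 : ℝ) : ℂ) := by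
  set θ : ℂ := j * Real.pi * α with hθ
  have h1 : Complex.exp (2 * Real.pi * Complex.I * α) ^ j = Complex.exp (θ * Complex.I) ^ 2 := by
    rw [← Complex.exp_nat_mul, ← Complex.exp_nat_mul, hθ]
    congr 1
    push_cast
    ring
  have h2 : Complex.exp (θ * Complex.I) ≠ 0 := Complex.exp_ne_zero _
  push_cast
  rw [← hθ, h1, Complex.sin, neg_mul, Complex.exp_neg]
  field_simp
  rw [Complex.I_sq]
  ring

theorem theorem3 (P : ℤ) (Q : ℕ) (hQ : 0 < Q) (hPQ : IsCoprime P (Q : ℤ))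
    (α : ℝ) (hα : α = (P : ℝ) / (Q : ℝ)) (E : ℂ) :
    (hofstadterHamiltonian Q α (Real.pi / (2 * Q)) (Real.pi / (2 * Q))
        - E • (1 : Matrix (Fin Q) (Fin Q) ℂ)).det
      = ∑ i ∈ Finset.range (Q / 2 + 1),
          (-1 : ℂ) ^ (Q + i) * 4 ^ i * E ^ (Q - 2 * i)
            * ((twoStepEsymm i (Q - 1)
                (fun j : ℕ => Real.sin ((j : ℝ) * Real.pi * α) ^ 2) : ℝ) : ℂ) := by
  have hQ0 : (Q : ℂ) ≠ 0 := Nat.cast_ne_zero.2 hQ.ne'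
  have hprim : IsPrimitiveRoot (Complex.exp (2 * Real.pi * Complex.I * α)) Q := by
    have h := Complex.isPrimitiveRoot_exp_of_isCoprime P Q hQ.ne' hPQ
    rw [hα]
    push_cast
    exact h
  have hzQ : Complex.exp (Complex.I * ((Real.pi / (2 * Q) : ℝ) : ℂ)) ^ Q = Complex.I := by
    refine Eq.trans ?_ Complex.exp_pi_div_two_mul_I
    rw [← Complex.exp_nat_mul]
    congr 1
    push_cast
    field_simp
  have hz0 := Complex.exp_ne_zero (Complex.I * ((Real.pi / (2 * Q) : ℝ) : ℂ))
  rw [det_hofstadterHamiltonian_sub hQ rfl rfl hprim hzQ, det_tridiagonal]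
  refine Finset.sum_congr rfl fun i hi => ?_
  have hi' : 2 * i ≤ Q := by
    rw [Finset.mem_range] at hi
    omega
  have hweights : (fun j : ℕ => Complex.exp (Complex.I * ((Real.pi / (2 * Q) : ℝ) : ℂ))
        * (1 - Complex.exp (2 * Real.pi * Complex.I * α) ^ j)
        * ((Complex.exp (Complex.I * ((Real.pi / (2 * Q) : ℝ) : ℂ)))⁻¹
        * (1 - (Complex.exp (2 * Real.pi * Complex.I * α) ^ j)⁻¹)))
      = fun j : ℕ => 4 * ((Real.sin ((j : ℝ) * Real.pi * α) ^ 2 : ℝ) : ℂ) := by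
    funext j
    rw [mul_mul_mul_comm, mul_inv_cancel₀ hz0, one_mul, one_sub_exp_mul_one_sub_inv]
  have hcast : ((twoStepEsymm i (Q - 1)
        (fun j : ℕ => Real.sin ((j : ℝ) * Real.pi * α) ^ 2) : ℝ) : ℂ)
      = twoStepEsymm i (Q - 1)
        (fun j : ℕ => ((Real.sin ((j : ℝ) * Real.pi * α) ^ 2 : ℝ) : ℂ)) := by
    simp only [twoStepEsymm, Complex.ofReal_sum, Complex.ofReal_prod]
  -- The diagonal entry is `-E`, so its power contributes this sign.
  have hsign : (-1 : ℂ) ^ Q = (-1) ^ (Q - 2 * i) := by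
    conv_lhs => rw [← Nat.sub_add_cancel hi', pow_add, pow_mul, neg_one_sq, one_pow, mul_one]
  rw [hweights, twoStepEsymm_mul_left, hcast, neg_pow E, pow_add, hsign]
  ring
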